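/- Let $\mathbb{A}$ be a finite set of size $s\ge 2$ and let $C\subseteq\mathbb{A}^n$ be a code; for $X\subseteq[n]$ let $C_X$ be its projection to the coordinates in $X$. Call $C$ \emph{almost affine} if $\log_s|C_X|\in\mathbb{Z}$ for every $X\subseteq[n]$. Let $1\le r\le k$ and $\delta\ge 2$. An \emph{$(r,\delta)$-locality set} of $C$ is a set $S\subseteq[n]$ with $|S|\le r+\delta-1$ such that for every $l\in S$ and every $L\subseteq S\setminus\{l\}$ with $|L|=\max\{|S|-(\delta-1),0\}$, the symbol $c_l$ is a function of $(c_i)_{i\in L}$, for $c\in C$. The code $C$ is a \emph{locally repairable code (LRC)} with parameters $(n,k,d,r,\delta)$ if $|C|=s^k$, its minimum distance is $d=\min\{|X| : X\subseteq[n],\ |C_{[n]\setminus X}|<|C|\}$, and every coordinate lies in an $(r,\delta)$-locality set. **Theorem.** Let $C$ be an almost affine LRC with parameters $(n,k,d,r,\delta)$, and let $$a=\left\lceil\tfrac{k}{r}\right\rceil r-k,\qquad b=\left\lceil\tfrac{n}{r+\delta-1}\right\rceil(r+\delta-1)-n .$$ Then the following hold. (i) If $b>a$ and $a<\left\lfloor\lceil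 k/r\rceil/2\right\rfloor$, then $d<n-k+1-\left(\lceil k/r\rceil-1\right)(\delta-1)$. (ii) If $b>a$, $\left\lfloor\lceil k/r\rceil/2\right\rfloor\le a<\lceil k/r\rceil-1$ and $$\left\lceil\tfrac{n}{r+\delta-1}\right\rceil<\left\lceil\tfrac{k}{r}\right\rceil-1+(b-a)\left(1+\tfrac1t\right),\qquad t=\left\lfloor\frac{a}{\lceil k/r\rceil-1-a}\right\rfloor ,$$ then $d<n-k+1-\left(\lceil k/r\rceil-1\right)(\delta-1)$. -/

import Mathlib

/-- The projection `C_X` of a code `C ⊆ Aⁿ` to the coordinates in `X`. -/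
def codeProj {n : ℕ} {A : Type*} (C : Set (Fin n → A)) (X : Finset (Fin n)) : Set (X → A) :=
  (fun c : Fin n → A => fun i : X => c i) '' C

/-- A code over a finite alphabet of size `s` is almost affine if `log_s |C_X|` is an integer
for every set `X` of coordinates, that is, if every `|C_X|` is a power of `s`
(in particular such a code is non-empty). -/
def IsAlmostAffine {n : ℕ} {A : Type*} [Fintype A] (C : Set (Fin n → A)) : Prop :=
  ∀ X : Finset (Fin n), ∃ m : ℕ, (codeProj C X).ncard = Fintype.card A ^ m

/-- `d` is the minimum distance of `C`: the least size of a set `X` of coordinates such that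
deleting the coordinates in `X` identifies two codewords, i.e. `|C_{[n] \ X}| < |C|`. -/
def IsMinDist {n : ℕ} {A : Type*} (C : Set (Fin n → A)) (d : ℕ) : Prop :=
  IsLeast {m : ℕ | ∃ X : Finset (Fin n), X.card = m ∧ (codeProj C Xᶜ).ncard < C.ncard} d

/-- `S` is an `(r, δ)`-locality set of `C`: it has at most `r + δ - 1` elements, and for every
`l ∈ S` and every `L ⊆ S \ {l}` with `|L| = |S| - (δ - 1)`, the symbol `c_l` is a function of
the symbols `c_i`, `i ∈ L`, for `c ∈ C`.
If `|S| < δ - 1`, the truncated difference makes `L` empty, so that the code is constant on `S`;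
thus in all cases the condition says that any `δ - 1` symbols in `S` can be recovered from the
remaining ones in `S`. -/
def IsLocalitySet {n : ℕ} {A : Type*} (C : Set (Fin n → A)) (r δ : ℕ)
    (S : Finset (Fin n)) : Prop :=
  S.card ≤ r + δ - 1 ∧
    ∀ l ∈ S, ∀ L : Finset (Fin n), L ⊆ S.erase l → L.card = S.card - (δ - 1) →
      ∃ f : (L → A) → A, ∀ c ∈ C, c l = f (fun i : L => c i)

/-- `C ⊆ Aⁿ` is a locally repairable code (with all-symbol locality) with parameters
`(n, k, d, r, δ)`. -/
structure IsLRC {n : ℕ} {A : Type*} [Fintype A] (C : Set (Fin n → A)) (k d r δ : ℕ) : Prop where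
  one_le_r : 1 ≤ r
  r_le_k : r ≤ k
  two_le_delta : 2 ≤ δ
  card_eq : C.ncard = Fintype.card A ^ k
  minDist : IsMinDist C d
  locality : ∀ i : Fin n, ∃ S : Finset (Fin n), i ∈ S ∧ IsLocalitySet C r δ S

/-! Put `ρ X = log_s |C_X|`, a matroid rank function, and write `μ = δ - 1`, `H = ⌈k/r⌉ - 1`, `g = H
- a ≥ 1`. If the strict inequality for `d` fails, every set of rank below `k` has nullity (size
minus rank) at most `H μ`; the proof contradicts this.

A local set added to a flat not containing it raises nullity by at least `μ` and rank by at most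
`r`. No surplus nullity is affordable, so unions of chains of at most `H` local sets are flats, and
a chain of `H + 1` has deficiency (the amount by which its size falls short of `(H + 1)(r + μ)`) at
most `a`: otherwise its rank would be below `k` with nullity at least `(H + 1) μ`.

Clusters, the connected components of overlapping local sets, partition the ground set. A cluster
`Y` built from `v` sets has deficiency `v - l` with `l = |Y| - v (r + μ - 1) ≤ 1`. The chain bound
forces any family of clusters with `∑ l ≤ g` to use at most `H` sets. The exchange argument of
`weight_le_of_loss_bound` turns this into a bound on the deficiency of the whole cover,
`exists_cover_deficiency_le`, which is incompatible with `b > a` in both regimes. -/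

section RankFunction

open Finset

/-- An integral matroid rank function, axiomatised by unit increments and by the monotonicity
of the closure operator. -/
structure IsRankFunction {E : Type*} [DecidableEq E] (ρ : Finset E → ℕ) : Prop where
  empty : ρ ∅ = 0
  le_insert : ∀ X i, ρ X ≤ ρ (insert i X)
  insert_le : ∀ X i, ρ (insert i X) ≤ ρ X + 1
  closure_mono : ∀ X Y i, X ⊆ Y → ρ (insert i X) = ρ X → ρ (insert i Y) = ρ Y

/-- `X` contains every element that it spans. -/
def IsRankFlat {E : Type*} [DecidableEq E] (ρ : Finset E → ℕ) (X : Finset E) : Prop :=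
  ∀ i, ρ (insert i X) = ρ X → i ∈ X

/-- A non-empty set with at most `r + μ` elements in which any `|S| - μ` elements span the rest. -/
structure IsRankLocal {E : Type*} [DecidableEq E] (ρ : Finset E → ℕ) (r μ : ℕ)
    (S : Finset E) : Prop where
  nonempty : S.Nonempty
  card_le : #S ≤ r + μ
  span : ∀ l ∈ S, ∀ L ⊆ S.erase l, #L = #S - μ → ρ (insert l L) = ρ L

/-- `X` is the union of `t` members of `P`, none of which lies in the union of its predecessors. -/
inductive IsChainUnion {E : Type*} [DecidableEq E] (P : Finset E → Prop) : ℕ → Finset E → Prop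
  | nil : IsChainUnion P 0 ∅
  | step {t : ℕ} {X S : Finset E} : IsChainUnion P t X → P S → ¬ S ⊆ X →
      IsChainUnion P (t + 1) (X ∪ S)

/-- `Y` is the union of `v ≥ 1` members of `P`, each of which after the first meets the union of
its predecessors without lying in it. -/
inductive IsConnectedUnion {E : Type*} [DecidableEq E] (P : Finset E → Prop) :
    ℕ → Finset E → Prop
  | single {S : Finset E} : P S → IsConnectedUnion P 1 S
  | step {v : ℕ} {Y S : Finset E} : IsConnectedUnion P v Y → P S → ¬ S ⊆ Y →
      (Y ∩ S).Nonempty → IsConnectedUnion P (v + 1) (Y ∪ S)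

/-- A connected union that is not met by any further member of `P`. -/
def IsCluster {E : Type*} [DecidableEq E] (P : Finset E → Prop) (Y : Finset E) : Prop :=
  (∃ v, IsConnectedUnion P v Y) ∧ ∀ S, P S → S ⊆ Y ∨ Disjoint S Y

variable {E : Type*} [DecidableEq E] {ρ : Finset E → ℕ}

/-! ### Rank, span and flats. -/

namespace IsRankFunction

theorem le_union (hρ : IsRankFunction ρ) (X S : Finset E) : ρ X ≤ ρ (X ∪ S) := by
  induction S using Finset.induction_on with
  | empty => simp
  | insert i S _ ih => rw [union_insert]; exact ih.trans (hρ.le_insert _ _)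

theorem mono (hρ : IsRankFunction ρ) {X Y : Finset E} (h : X ⊆ Y) : ρ X ≤ ρ Y := by
  simpa [union_eq_right.2 h] using hρ.le_union X Y

theorem union_le (hρ : IsRankFunction ρ) (X S : Finset E) : ρ (X ∪ S) ≤ ρ X + #S := by
  induction S using Finset.induction_on with
  | empty => simp
  | insert i S hi ih =>
    rw [union_insert, card_insert_of_notMem hi]
    have := hρ.insert_le (X ∪ S) i
    omega

theorem union_eq_of_span (hρ : IsRankFunction ρ) (X S : Finset E)
    (h : ∀ i ∈ S, ρ (insert i X) = ρ X) : ρ (X ∪ S) = ρ X := by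
  induction S using Finset.induction_on with
  | empty => simp
  | insert i S _ ih =>
    rw [union_insert, hρ.closure_mono X _ i subset_union_left (h i (mem_insert_self _ _))]
    exact ih fun j hj => h j (mem_insert_of_mem hj)

theorem exists_flat [Fintype E] (hρ : IsRankFunction ρ) (X : Finset E) :
    ∃ F, X ⊆ F ∧ ρ F = ρ X ∧ IsRankFlat ρ F := by
  have hcl := hρ.union_eq_of_span X (univ.filter fun i => ρ (insert i X) = ρ X) (by simp)
  refine ⟨_, subset_union_left, hcl, fun i hi => ?_⟩
  have h1 := hρ.mono (insert_subset_insert i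
    (subset_union_left (s₁ := X) (s₂ := univ.filter fun i => ρ (insert i X) = ρ X)))
  have h2 := hρ.le_insert X i
  refine mem_union_right _ (mem_filter.2 ⟨mem_univ _, ?_⟩)
  omega

/-- If `X` met `S` in `|S| - μ` elements, these would span `S` into the flat `X`. So `X ∩ S` extends
to a spanning subset of `S` of size `|S| - μ`, and only its elements outside `X` can raise the rank.
-/
theorem flat_union_local (hρ : IsRankFunction ρ) {r μ : ℕ} {X S : Finset E}
    (hX : IsRankFlat ρ X) (hS : IsRankLocal ρ r μ S) (hSX : ¬ S ⊆ X) :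
    ρ (X ∪ S) + μ + #(X ∩ S) ≤ ρ X + #S := by
  by_cases hc : #S - μ ≤ #(X ∩ S)
  · obtain ⟨L, hL, hLc⟩ := exists_subset_card_eq hc
    obtain ⟨l, hl, hlX⟩ := not_subset.1 hSX
    refine absurd (hX l ?_) hlX
    refine hρ.closure_mono L X l (hL.trans inter_subset_left) (hS.span l hl L ?_ hLc)
    exact fun x hx => mem_erase.2
      ⟨fun h => hlX (h ▸ (mem_inter.1 (hL hx)).1), (mem_inter.1 (hL hx)).2⟩
  · push Not at hc
    obtain ⟨L, hXL, hLS, hLc⟩ := exists_subsuperset_card_eq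
      (inter_subset_right (s₁ := X) (s₂ := S)) hc.le (Nat.sub_le _ _)
    have h1 : ρ (X ∪ L ∪ S) = ρ (X ∪ L) := by
      refine hρ.union_eq_of_span _ _ fun i hi => ?_
      by_cases hiL : i ∈ L
      · rw [insert_eq_of_mem (mem_union_right _ hiL)]
      · exact hρ.closure_mono L _ i subset_union_right
          (hS.span i hi L (fun x hx => mem_erase.2 ⟨fun h => hiL (h ▸ hx), hLS hx⟩) hLc)
    have h2 : ρ (X ∪ S) ≤ ρ (X ∪ L) :=
      h1 ▸ hρ.mono (union_subset_union_left subset_union_left)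
    have h3 := hρ.union_le X (L \ X)
    rw [union_sdiff_self_eq_union] at h3
    have h4 := card_sdiff_add_card_inter L X
    have h5 : #(X ∩ S) ≤ #(L ∩ X) :=
      card_le_card fun x hx => mem_inter.2 ⟨hXL hx, (mem_inter.1 hx).1⟩
    omega

end IsRankFunction

/-! ### Connected unions and clusters. -/

section Connected

variable {P : Finset E → Prop}

theorem IsConnectedUnion.pos {v : ℕ} {Y : Finset E} (h : IsConnectedUnion P v Y) : 1 ≤ v := by
  cases h <;> omega

theorem IsConnectedUnion.card_le {v c : ℕ} {Y : Finset E} (hP : ∀ S, P S → #S ≤ c + 1)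
    (h : IsConnectedUnion P v Y) : #Y ≤ v * c + 1 := by
  induction h with
  | single hS => simpa using hP _ hS
  | step _ hS _ hne ih =>
    rename_i v Y S _ _
    have h1 := card_union_add_card_inter Y S
    have h2 := hP _ hS
    have h3 := hne.card_pos
    rw [add_mul, one_mul]
    omega

theorem IsConnectedUnion.le_card {v : ℕ} {Y : Finset E} (hP : ∀ S, P S → S.Nonempty)
    (h : IsConnectedUnion P v Y) : v ≤ #Y := by
  induction h with
  | single hS => exact (hP _ hS).card_pos
  | step _ _ hn _ ih =>
    refine ih.trans_lt (card_lt_card ?_)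
    exact ⟨subset_union_left, fun h => hn (subset_union_right.trans h)⟩

theorem IsConnectedUnion.exists_subset {v j : ℕ} {Y : Finset E} (h : IsConnectedUnion P v Y)
    (hj : 1 ≤ j) (hjv : j ≤ v) : ∃ Z ⊆ Y, IsConnectedUnion P j Z := by
  induction h with
  | single hS =>
    obtain rfl : j = 1 := by omega
    exact ⟨_, Subset.rfl, .single hS⟩
  | step hY hS hn hne ih =>
    rcases hjv.eq_or_lt with rfl | hlt
    · exact ⟨_, Subset.rfl, .step hY hS hn hne⟩
    · obtain ⟨Z, hZ, hZc⟩ := ih (by omega)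
      exact ⟨Z, hZ.trans subset_union_left, hZc⟩

theorem IsConnectedUnion.subset_or_disjoint {v : ℕ} {Y Z : Finset E}
    (h : IsConnectedUnion P v Z) (hY : ∀ S, P S → S ⊆ Y ∨ Disjoint S Y) :
    Z ⊆ Y ∨ Disjoint Z Y := by
  induction h with
  | single hS => exact hY _ hS
  | step _ hS _ hne ih =>
    obtain ⟨x, hx⟩ := hne
    rw [mem_inter] at hx
    rcases ih with h1 | h1 <;> rcases hY _ hS with h2 | h2
    · exact .inl (union_subset h1 h2)
    · exact absurd (h1 hx.1) (disjoint_left.1 h2 hx.2)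
    · exact absurd (h2 hx.2) (disjoint_left.1 h1 hx.1)
    · exact .inr (disjoint_union_left.2 ⟨h1, h2⟩)

theorem IsCluster.eq_or_disjoint {Y Z : Finset E} (hY : IsCluster P Y) (hZ : IsCluster P Z) :
    Y = Z ∨ Disjoint Y Z := by
  obtain ⟨⟨v, hv⟩, hY'⟩ := hY
  obtain ⟨⟨w, hw⟩, hZ'⟩ := hZ
  rcases hv.subset_or_disjoint hZ' with h1 | h1
  · rcases hw.subset_or_disjoint hY' with h2 | h2
    · exact .inl (h1.antisymm h2)
    · exact .inr h2.symm
  · exact .inr h1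

theorem exists_isCluster [Fintype E] (hP : ∀ S, P S → S.Nonempty) {S : Finset E} (hS : P S) :
    ∃ Y, S ⊆ Y ∧ IsCluster P Y := by
  classical
  let p : ℕ → Prop := fun v => ∃ Y, S ⊆ Y ∧ IsConnectedUnion P v Y
  have hb : ∀ v, p v → v ≤ Fintype.card E := fun v ⟨Y, _, hY⟩ =>
    (hY.le_card hP).trans (card_le_univ _)
  have h1 : p 1 := ⟨S, Subset.rfl, .single hS⟩
  -- A longest connected union containing `S` is a cluster: a set meeting it without lying in it
  -- would lengthen it.
  obtain ⟨Y, hSY, hY⟩ := Nat.findGreatest_spec (hb 1 h1) h1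
  refine ⟨Y, hSY, ⟨_, hY⟩, fun T hT => ?_⟩
  by_contra! hcon
  rw [not_disjoint_iff] at hcon
  obtain ⟨hn, x, hxT, hxY⟩ := hcon
  have h2 : p (Nat.findGreatest p (Fintype.card E) + 1) :=
    ⟨Y ∪ T, hSY.trans subset_union_left, hY.step hT hn ⟨x, mem_inter.2 ⟨hxY, hxT⟩⟩⟩
  have := Nat.le_findGreatest (hb _ h2) h2
  omega

theorem IsChainUnion.union_connected {t v : ℕ} {X Y : Finset E} (hP : ∀ S, P S → S.Nonempty)
    (hX : IsChainUnion P t X) (hY : IsConnectedUnion P v Y) (hXY : Disjoint X Y) :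
    IsChainUnion P (t + v) (X ∪ Y) := by
  induction hY with
  | single hS =>
    refine hX.step hS fun h => ?_
    obtain ⟨x, hx⟩ := hP _ hS
    exact disjoint_left.1 hXY (h hx) hx
  | step _ hS hn _ ih =>
    rw [disjoint_union_right] at hXY
    rw [← union_assoc, ← add_assoc]
    refine (ih hXY.1).step hS fun h => hn fun x hx => ?_
    exact (mem_union.1 (h hx)).resolve_left fun hxX => disjoint_left.1 hXY.2 hxX hx

theorem isChainUnion_biUnion (hP : ∀ S, P S → S.Nonempty) (v : Finset E → ℕ)
    (Q : Finset (Finset E)) (hv : ∀ Y ∈ Q, IsConnectedUnion P (v Y) Y)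
    (hQ : (Q : Set (Finset E)).PairwiseDisjoint id) :
    IsChainUnion P (∑ Y ∈ Q, v Y) (Q.biUnion id) := by
  induction Q using Finset.induction_on with
  | empty => simpa using IsChainUnion.nil
  | insert Z Q hZ ih =>
    rw [sum_insert hZ, biUnion_insert, add_comm, union_comm]
    refine (ih (fun Y hY => hv Y (mem_insert_of_mem hY))
      (hQ.subset (by simp))).union_connected hP (hv Z (mem_insert_self _ _)) ?_
    refine (disjoint_biUnion_left _ _ _).2 fun Y hY => ?_
    exact hQ (by simp [hY]) (by simp) (ne_of_mem_of_not_mem hY hZ)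

end Connected

/-- An extremal estimate: if no subfamily of `U` with total loss at most `g` has total size more
than `a + g`, then the sizes outside a largest such subfamily are at most `a / g + 1`. -/
theorem weight_le_of_loss_bound {ι : Type*} [DecidableEq ι] (U : Finset ι) (v : ι → ℕ)
    (l : ι → ℤ) (a g : ℕ) (hg : 1 ≤ g) (hv : ∀ i ∈ U, 1 ≤ v i) (hl : ∀ i ∈ U, l i ≤ 1)
    (hQ : ∀ Q ⊆ U, ∑ i ∈ Q, l i ≤ g → ∑ i ∈ Q, v i ≤ a + g)
    (hU : a + g < ∑ i ∈ U, v i) :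
    (((a / g : ℕ) : ℤ) + 1) * (∑ i ∈ U, ((v i : ℤ) - l i) - a) + (a / g : ℕ) * ((a : ℤ) + g)
      ≤ (a / g : ℕ) * ∑ i ∈ U, (v i : ℤ) := by
  obtain ⟨Q, hQmem, hmax⟩ := exists_max_image (U.powerset.filter fun Q => ∑ i ∈ Q, l i ≤ g)
    (fun Q => ∑ i ∈ Q, v i) ⟨∅, by simp⟩
  simp only [mem_filter, mem_powerset] at hQmem hmax
  obtain ⟨hQU, hQl⟩ := hQmem
  have hV := hQ Q hQU hQl
  -- By maximality of `Q`, adding any outside member exceeds the loss budget; as each loss is at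
  -- most 1, the budget is met exactly.
  have hadd : ∀ z ∈ U, z ∉ Q → (g : ℤ) < ∑ i ∈ Q, l i + l z := by
    intro z hzU hzQ
    by_contra! hcon
    have := hmax (insert z Q) ⟨insert_subset hzU hQU, by rw [sum_insert hzQ]; linarith⟩
    rw [sum_insert hzQ] at this
    have := hv z hzU
    omega
  obtain ⟨z₀, hz₀U, hz₀Q⟩ : ∃ z ∈ U, z ∉ Q := by
    by_contra! hcon
    rw [hQU.antisymm hcon] at hV
    omega
  have hloss : ∑ i ∈ Q, l i = g := by
    have := hadd z₀ hz₀U hz₀Q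
    have := hl z₀ hz₀U
    omega
  have hout : ∀ z ∈ U \ Q, l z = 1 ∧ v z ≤ a / g + 1 := by
    intro z hz
    rw [mem_sdiff] at hz
    have h1 := hadd z hz.1 hz.2
    have h2 := hl z hz.1
    refine ⟨by omega, ?_⟩
    -- Exchanging `i` for `z` preserves the loss, so maximality compares their sizes. At least `g`
    -- such `i` share total size at most `a + g`.
    have hswap : ∀ i ∈ Q.filter (fun i => l i = 1), v z ≤ v i := by
      intro i hi
      rw [mem_filter] at hi
      have hz' : z ∉ Q.erase i := fun h => hz.2 (mem_of_mem_erase h)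
      have e1 := sum_erase_add Q l hi.1
      have e2 := sum_erase_add Q v hi.1
      have := hmax (insert z (Q.erase i))
        ⟨insert_subset hz.1 ((erase_subset _ _).trans hQU), by rw [sum_insert hz']; omega⟩
      rw [sum_insert hz'] at this
      omega
    have hcard : (g : ℤ) ≤ #(Q.filter (fun i => l i = 1)) := by
      rw [← hloss, ← sum_filter_add_sum_filter_not Q (fun i => l i = 1)]
      have e1 : ∑ i ∈ Q.filter (fun i => l i = 1), l i = #(Q.filter (fun i => l i = 1)) := by
        rw [sum_congr rfl fun i hi => (mem_filter.1 hi).2]; simp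
      have e2 : ∑ i ∈ Q.filter (fun i => ¬ l i = 1), l i ≤ 0 :=
        sum_nonpos fun i hi => by
          rw [mem_filter] at hi
          have := hl i (hQU hi.1)
          omega
      omega
    have h3 : g * v z ≤ a + g := by
      calc g * v z ≤ #(Q.filter (fun i => l i = 1)) * v z :=
            Nat.mul_le_mul_right _ (by exact_mod_cast hcard)
        _ ≤ ∑ i ∈ Q.filter (fun i => l i = 1), v i := by
            simpa using card_nsmul_le_sum _ _ _ hswap
        _ ≤ ∑ i ∈ Q, v i := sum_le_sum_of_subset (filter_subset _ _)
        _ ≤ a + g := hV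
    rw [← Nat.add_div_right a hg, Nat.le_div_iff_mul_le hg, mul_comm]
    exact h3
  have hrest : (((a / g : ℕ) : ℤ) + 1) * ∑ i ∈ U \ Q, ((v i : ℤ) - l i)
      ≤ (a / g : ℕ) * ∑ i ∈ U \ Q, (v i : ℤ) := by
    rw [mul_sum, mul_sum]
    refine sum_le_sum fun i hi => ?_
    obtain ⟨h1, h2⟩ := hout i hi
    have h2' : (v i : ℤ) ≤ (a / g : ℕ) + 1 := by exact_mod_cast h2
    rw [h1]
    linarith
  have hV' : ∑ i ∈ Q, (v i : ℤ) ≤ a + g := by exact_mod_cast hV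
  rw [← sum_sdiff hQU, ← sum_sdiff (f := fun i => (v i : ℤ)) hQU, sum_sub_distrib (s := Q), hloss]
  linarith

theorem IsChainUnion.card_le {r μ t : ℕ} {X : Finset E}
    (h : IsChainUnion (IsRankLocal ρ r μ) t X) : #X ≤ t * (r + μ) := by
  induction h with
  | nil => simp
  | step _ hS _ ih =>
    have h2 := hS.card_le
    refine (card_union_le _ _).trans ?_
    rw [add_mul, one_mul]
    omega

/-! ### Consequences of attaining the Singleton-type bound. -/

section Optimal

variable [Fintype E] {r μ k H a g : ℕ}

/-- A set of rank at most `t r` extends, by adding local sets, to one of rank at most `H r` while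
keeping its excess nullity. -/
theorem excess_eq_zero_of_optimal (hρ : IsRankFunction ρ) (hHk : H * r < k) (hk : ρ univ = k)
    (hcov : ∀ i, ∃ S, i ∈ S ∧ IsRankLocal ρ r μ S)
    (hopt : ∀ Y, ρ Y < k → #Y ≤ ρ Y + H * μ) {c : ℕ} (s : ℕ) :
    ∀ (t : ℕ) (X : Finset E), t + s = H → ρ X ≤ t * r → ρ X + t * μ + c ≤ #X → c = 0 := by
  induction s with
  | zero =>
    intro t X ht hX hc
    obtain rfl : t = H := by omega
    have := hopt X (by omega)
    omega
  | succ s ih =>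
    intro t X ht hX hc
    obtain ⟨F, hXF, hF, hflat⟩ := hρ.exists_flat X
    have hne : F ≠ univ := by
      rintro rfl
      have : t * r ≤ H * r := Nat.mul_le_mul_right _ (by omega)
      omega
    obtain ⟨i, hi⟩ : ∃ i, i ∉ F := by
      by_contra! h
      exact hne (eq_univ_of_forall h)
    obtain ⟨S, hiS, hS⟩ := hcov i
    have h1 := hρ.flat_union_local hflat hS fun h => hi (h hiS)
    have h2 := card_union_add_card_inter F S
    have h3 := card_le_card hXF
    have h4 := hS.card_le
    refine ih (t + 1) (F ∪ S) (by omega) ?_ ?_ <;> rw [add_mul, one_mul] <;> omega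

/-- A spanned element outside `X` would give one unit of excess nullity, ruled out by
`excess_eq_zero_of_optimal`. -/
theorem isRankFlat_of_optimal (hρ : IsRankFunction ρ) (hHk : H * r < k) (hk : ρ univ = k)
    (hcov : ∀ i, ∃ S, i ∈ S ∧ IsRankLocal ρ r μ S)
    (hopt : ∀ Y, ρ Y < k → #Y ≤ ρ Y + H * μ) {t : ℕ} {X : Finset E} (ht : t ≤ H)
    (hX : ρ X + t * μ ≤ #X) (hX' : #X ≤ t * (r + μ)) : IsRankFlat ρ X := by
  intro i hi
  by_contra hiX
  have h := excess_eq_zero_of_optimal hρ hHk hk hcov hopt (c := 1) (H - t) t (insert i X)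
    (by omega) ?_ ?_
  · omega
  · rw [mul_add] at hX'
    omega
  · rw [card_insert_of_notMem hiX]
    omega

theorem IsChainUnion.nullity (hρ : IsRankFunction ρ) (hHk : H * r < k) (hk : ρ univ = k)
    (hcov : ∀ i, ∃ S, i ∈ S ∧ IsRankLocal ρ r μ S)
    (hopt : ∀ Y, ρ Y < k → #Y ≤ ρ Y + H * μ) {t : ℕ} {X : Finset E}
    (h : IsChainUnion (IsRankLocal ρ r μ) t X) (ht : t ≤ H + 1) : ρ X + t * μ ≤ #X := by
  induction h with
  | nil => simp [hρ.empty]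
  | step hX hS hn ih =>
    rename_i t X S
    have h0 := ih (by omega)
    have hflat := isRankFlat_of_optimal hρ hHk hk hcov hopt (by omega) h0 hX.card_le
    have h1 := hρ.flat_union_local hflat hS hn
    have h2 := card_union_add_card_inter X S
    rw [add_mul, one_mul]
    omega

/-- The total deficiency of a chain of at most `H + 1` local sets is at most `a`. -/
theorem IsChainUnion.le_card_add (hρ : IsRankFunction ρ) (hHk : H * r < k) (hk : ρ univ = k)
    (hcov : ∀ i, ∃ S, i ∈ S ∧ IsRankLocal ρ r μ S) (hμ : 1 ≤ μ) (ha : a + k = (H + 1) * r)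
    (hopt : ∀ Y, ρ Y < k → #Y ≤ ρ Y + H * μ) (s : ℕ) : ∀ (t : ℕ) (X : Finset E), t + s = H + 1 →
    IsChainUnion (IsRankLocal ρ r μ) t X → t * (r + μ) ≤ #X + a := by
  induction s with
  | zero =>
    intro t X ht hX
    obtain rfl : t = H + 1 := by omega
    have h1 := hX.nullity hρ hHk hk hcov hopt le_rfl
    by_contra! hcon
    rw [mul_add] at hcon
    have h2 := hopt X (by omega)
    rw [add_mul, one_mul] at h1
    omega
  | succ s ih =>
    intro t X ht hX
    have h1 := hX.nullity hρ hHk hk hcov hopt (by omega)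
    have h2 := hX.card_le
    have hne : X ≠ univ := by
      rintro rfl
      have : t * r ≤ H * r := Nat.mul_le_mul_right _ (by omega)
      rw [mul_add] at h2
      omega
    obtain ⟨i, hi⟩ : ∃ i, i ∉ X := by
      by_contra! h
      exact hne (eq_univ_of_forall h)
    obtain ⟨S, hiS, hS⟩ := hcov i
    have h3 := ih (t + 1) (X ∪ S) (by omega) (hX.step hS fun h => hi (h hiS))
    have h4 := card_union_le X S
    have h5 := hS.card_le
    rw [add_mul, one_mul] at h3
    omega

/-- If every set of rank less than `k` has nullity at most `H μ`, then the ground set is covered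
by `m` local sets for which the total deficiency `m (r + μ) - n` obeys a linear bound in `m`. -/
theorem exists_cover_deficiency_le (hρ : IsRankFunction ρ) (hHk : H * r < k) (hk : ρ univ = k)
    (hcov : ∀ i, ∃ S, i ∈ S ∧ IsRankLocal ρ r μ S) (hμ : 1 ≤ μ) (ha : a + k = (H + 1) * r)
    (hopt : ∀ Y, ρ Y < k → #Y ≤ ρ Y + H * μ) (hg : 1 ≤ g) (hH : a + g = H) :
    ∃ m : ℕ, Fintype.card E ≤ m * (r + μ) ∧
      (((a / g : ℕ) : ℤ) + 1) * ((m : ℤ) * (r + μ) - Fintype.card E - a) + (a / g : ℕ) * (H : ℤ)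
        ≤ (a / g : ℕ) * (m : ℤ) := by
  classical
  set P := IsRankLocal ρ r μ with hP
  have hne : ∀ S, P S → S.Nonempty := fun S hS => hS.nonempty
  obtain ⟨c, hc⟩ : ∃ c, r + μ = c + 1 := ⟨r + μ - 1, by omega⟩
  have hcle : ∀ S, P S → #S ≤ c + 1 := fun S hS => hc ▸ hS.card_le
  set U : Finset (Finset E) := univ.filter (IsCluster P) with hUdef
  have hUc : ∀ Y, Y ∈ U ↔ IsCluster P Y := by simp [hUdef]
  have hex : ∀ Y, ∃ v, Y ∈ U → IsConnectedUnion P v Y := by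
    intro Y
    by_cases hY : Y ∈ U
    · obtain ⟨v, hv⟩ := ((hUc Y).1 hY).1
      exact ⟨v, fun _ => hv⟩
    · exact ⟨0, fun h => absurd h hY⟩
  choose v hv using hex
  have hdisj : (U : Set (Finset E)).PairwiseDisjoint id := fun Y hY Z hZ hYZ =>
    (((hUc Y).1 hY).eq_or_disjoint ((hUc Z).1 hZ)).resolve_left hYZ
  have hcard : ∀ Q ⊆ U, #(Q.biUnion id) = ∑ Y ∈ Q, #Y := fun Q hQ =>
    card_biUnion (hdisj.subset (coe_subset.2 hQ))
  have hchain : ∀ Q ⊆ U, IsChainUnion P (∑ Y ∈ Q, v Y) (Q.biUnion id) := fun Q hQ =>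
    isChainUnion_biUnion hne v Q (fun Y hY => hv Y (hQ hY)) (hdisj.subset (coe_subset.2 hQ))
  have hUuniv : U.biUnion id = univ := by
    refine eq_univ_of_forall fun i => ?_
    obtain ⟨S, hiS, hS⟩ := hcov i
    obtain ⟨Y, hSY, hY⟩ := exists_isCluster hne hS
    exact mem_biUnion.2 ⟨Y, (hUc Y).2 hY, hSY hiS⟩
  have hchainU := hchain U Subset.rfl
  rw [hUuniv] at hchainU
  have hcardU := hcard U Subset.rfl
  rw [hUuniv, card_univ] at hcardU
  let l : Finset E → ℤ := fun Y => #Y - v Y * c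
  have hl : ∀ Y ∈ U, l Y ≤ 1 := fun Y hY => by
    have : (#Y : ℤ) ≤ v Y * c + 1 := by exact_mod_cast (hv Y hY).card_le hcle
    simp only [l]
    linarith
  have hlsum : ∀ Q : Finset (Finset E),
      ∑ Y ∈ Q, l Y = ((∑ Y ∈ Q, #Y : ℕ) : ℤ) - (∑ Y ∈ Q, v Y : ℕ) * c := fun Q => by
    simp only [l]
    rw [sum_sub_distrib, ← sum_mul]
    push_cast
    ring
  have hlong : H < ∑ Y ∈ U, v Y := by
    by_contra! hcon
    have h1 := hchainU.nullity hρ hHk hk hcov hopt (by omega)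
    have h2 := hchainU.card_le
    rw [mul_add] at h2
    have := Nat.mul_le_mul_right r hcon
    omega
  have hQ : ∀ Q ⊆ U, ∑ Y ∈ Q, l Y ≤ g → ∑ Y ∈ Q, v Y ≤ a + g := by
    intro Q
    induction Q using Finset.strongInduction with
    | H Q ih =>
    intro hQU hQl
    by_contra! hcon
    -- Drop a cluster of positive loss; if there is none, drop any, since the remaining loss is then
    -- at most 0.
    obtain ⟨Z, hZ, hZl⟩ : ∃ Z ∈ Q, ∑ Y ∈ Q.erase Z, l Y ≤ g - 1 := by
      by_cases hone : ∃ Z ∈ Q, 1 ≤ l Z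
      · obtain ⟨Z, hZ, h1⟩ := hone
        refine ⟨Z, hZ, ?_⟩
        have := sum_erase_add Q l hZ
        omega
      · push Not at hone
        have hQne : Q.Nonempty := by
          rw [nonempty_iff_ne_empty]
          rintro rfl
          simp at hcon
        obtain ⟨Z, hZ⟩ := hQne
        refine ⟨Z, hZ, ?_⟩
        have : ∑ Y ∈ Q.erase Z, l Y ≤ 0 := sum_nonpos fun Y hY => by
          have := hone Y (mem_of_mem_erase hY)
          omega
        omega
    have hQ'U := (erase_subset Z Q).trans hQU
    have h1 := ih _ (erase_ssubset hZ) hQ'U (by omega)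
    have h2 := sum_erase_add Q v hZ
    -- Cut `Z` so that exactly `H + 1` sets are used. The cut piece has loss at most 1, so the total
    -- is at most `g`, while deficiency at most `a` requires loss at least `H + 1 - a = g + 1`.
    obtain ⟨Y, hYZ, hY⟩ := (hv Z (hQU hZ)).exists_subset
      (j := H + 1 - ∑ Y ∈ Q.erase Z, v Y) (by omega) (by omega)
    have hd : Disjoint ((Q.erase Z).biUnion id) Y := by
      refine (disjoint_biUnion_left _ _ _).2 fun T hT => ?_
      exact (hdisj (hQ'U hT) (hQU hZ) (ne_of_mem_erase hT)).mono_right hYZ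
    have h3 := (hchain _ hQ'U).union_connected hne hY hd
    rw [Nat.add_sub_cancel' (by omega)] at h3
    have h4 := IsChainUnion.le_card_add hρ hHk hk hcov hμ ha hopt 0 (H + 1) _ rfl h3
    rw [card_union_of_disjoint hd, hcard _ hQ'U, hc] at h4
    have h5 := hY.card_le hcle
    have h6 := hlsum (Q.erase Z)
    obtain ⟨j, hj⟩ : ∃ j, j + ∑ Y ∈ Q.erase Z, v Y = H + 1 :=
      ⟨H + 1 - ∑ Y ∈ Q.erase Z, v Y, by omega⟩
    rw [← hj, Nat.add_sub_cancel] at h5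
    have h7 : (j + ∑ Y ∈ Q.erase Z, v Y) * c = (H + 1) * c := by rw [hj]
    rw [add_mul] at h7
    zify at h4 h5 h6 h7 hH
    linarith
  refine ⟨∑ Y ∈ U, v Y, by simpa using hchainU.card_le, ?_⟩
  have key := weight_le_of_loss_bound U v l a g hg (fun Y hY => (hv Y hY).pos) hl hQ
    (by omega)
  rw [sum_sub_distrib, hlsum, ← hcardU] at key
  have hc' : (r : ℤ) + μ = c + 1 := by exact_mod_cast hc
  have hH' : (H : ℤ) = a + g := by exact_mod_cast hH.symm
  rw [hc', hH']
  push_cast at key ⊢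
  convert key using 2
  ring

end Optimal

end RankFunction

/-! ### From almost affine codes to rank functions. -/

section AlmostAffine

variable {n : ℕ} {A : Type*} {C : Set (Fin n → A)}

theorem image_restrict_codeProj {X Y : Finset (Fin n)} (h : X ⊆ Y) :
    (fun (c : Y → A) (i : X) => c ⟨i, h i.2⟩) '' codeProj C Y = codeProj C X := by
  simp [codeProj, Set.image_image]

theorem ncard_codeProj_univ : (codeProj C Finset.univ).ncard = C.ncard := by
  refine Set.ncard_image_of_injective _ fun c c' h => ?_
  funext i
  exact congrFun h ⟨i, Finset.mem_univ i⟩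

variable [Fintype A]

theorem ncard_codeProj_mono {X Y : Finset (Fin n)} (h : X ⊆ Y) :
    (codeProj C X).ncard ≤ (codeProj C Y).ncard := by
  rw [← image_restrict_codeProj h]
  exact Set.ncard_image_le (Set.toFinite _)

theorem ncard_codeProj_insert_le (X : Finset (Fin n)) (i : Fin n) :
    (codeProj C (insert i X)).ncard ≤ (codeProj C X).ncard * Fintype.card A := by
  have hinj : Set.InjOn (fun c : ↥(insert i X) → A =>
      ((fun j : X => c ⟨j, Finset.mem_insert_of_mem j.2⟩), c ⟨i, Finset.mem_insert_self _ _⟩))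
      (codeProj C (insert i X)) := by
    intro c _ c' _ h
    rw [Prod.mk.injEq] at h
    funext ⟨j, hj⟩
    rcases Finset.mem_insert.1 hj with rfl | hjX
    · exact h.2
    · exact congrFun h.1 ⟨j, hjX⟩
  rw [← hinj.ncard_image]
  calc _ ≤ (codeProj C X ×ˢ (Set.univ : Set A)).ncard := by
        refine Set.ncard_le_ncard ?_ (Set.toFinite _)
        rintro _ ⟨_, ⟨c, hc, rfl⟩, rfl⟩
        exact ⟨⟨c, hc, rfl⟩, trivial⟩
    _ = _ := by rw [Set.ncard_prod, Set.ncard_univ, Nat.card_eq_fintype_card]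

/-- Adding a coordinate keeps the size of the projection iff the coordinate is determined. -/
theorem ncard_codeProj_insert_eq_iff (X : Finset (Fin n)) (i : Fin n) :
    (codeProj C (insert i X)).ncard = (codeProj C X).ncard ↔
      ∀ c ∈ C, ∀ c' ∈ C, (∀ j ∈ X, c j = c' j) → c i = c' i := by
  rw [← image_restrict_codeProj (C := C) (Finset.subset_insert i X), eq_comm,
    Set.ncard_image_iff (Set.toFinite _)]
  constructor
  · intro h c hc c' hc' hX
    have := h ⟨c, hc, rfl⟩ ⟨c', hc', rfl⟩ (funext fun j => hX j j.2)
    exact congrFun this ⟨i, Finset.mem_insert_self _ _⟩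
  · rintro h _ ⟨c, hc, rfl⟩ _ ⟨c', hc', rfl⟩ hcc
    have hX : ∀ j ∈ X, c j = c' j := fun j hj => congrFun hcc ⟨j, hj⟩
    funext ⟨j, hj⟩
    rcases Finset.mem_insert.1 hj with rfl | hjX
    · exact h c hc c' hc' hX
    · exact hX j hjX

/-- The rank function of an almost affine code. -/
theorem IsAlmostAffine.exists_rankFunction (hA : 2 ≤ Fintype.card A) (hC : IsAlmostAffine C) :
    ∃ ρ : Finset (Fin n) → ℕ, IsRankFunction ρ ∧
      ∀ X, (codeProj C X).ncard = Fintype.card A ^ ρ X := by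
  choose ρ hρ using hC
  have hlt : 1 < Fintype.card A := hA
  have heq : ∀ X Y, ρ X = ρ Y ↔ (codeProj C X).ncard = (codeProj C Y).ncard := fun X Y => by
    rw [hρ, hρ, Nat.pow_right_inj hlt]
  refine ⟨ρ, ⟨?_, fun X i => ?_, fun X i => ?_, fun X Y i hXY h => ?_⟩, hρ⟩
  · have h1 : (codeProj C ∅).ncard ≤ 1 := Set.ncard_le_one_of_subsingleton _
    rw [hρ] at h1
    by_contra h0
    exact absurd (Nat.one_lt_pow h0 hlt) (by omega)
  · have := ncard_codeProj_mono (C := C) (Finset.subset_insert i X)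
    rwa [hρ, hρ, Nat.pow_le_pow_iff_right hlt] at this
  · have := ncard_codeProj_insert_le (C := C) X i
    rwa [hρ, hρ, ← pow_succ, Nat.pow_le_pow_iff_right hlt] at this
  · rw [heq, ncard_codeProj_insert_eq_iff] at h ⊢
    exact fun c hc c' hc' hY => h c hc c' hc' fun j hj => hY j (hXY hj)

theorem IsLocalitySet.isRankLocal {ρ : Finset (Fin n) → ℕ} {r δ : ℕ} {S : Finset (Fin n)}
    (hA : 2 ≤ Fintype.card A) (hρ : ∀ X, (codeProj C X).ncard = Fintype.card A ^ ρ X)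
    (hδ : 1 ≤ δ) (hne : S.Nonempty) (hS : IsLocalitySet C r δ S) :
    IsRankLocal ρ r (δ - 1) S := by
  refine ⟨hne, by have := hS.1; omega, fun l hl L hL hLc => ?_⟩
  have hlt : 1 < Fintype.card A := hA
  rw [← Nat.pow_right_inj hlt, ← hρ, ← hρ, ncard_codeProj_insert_eq_iff]
  obtain ⟨f, hf⟩ := hS.2 l hl L hL hLc
  intro c hc c' hc' hX
  rw [hf c hc, hf c' hc']
  exact congrArg f (funext fun i => hX i i.2)

/-- If `d` attains the Singleton-type bound, then sets of rank less than `k` have nullity at most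
`H (δ - 1)`. -/
theorem IsMinDist.card_le_rank_add {ρ : Finset (Fin n) → ℕ} {k d M : ℕ}
    (hA : 2 ≤ Fintype.card A) (hρ : ∀ X, (codeProj C X).ncard = Fintype.card A ^ ρ X)
    (hR : IsRankFunction ρ) (hk : ρ Finset.univ = k) (hd : IsMinDist C d)
    (hopt : n + 1 ≤ d + k + M) (s : ℕ) :
    ∀ Y, ρ Y + s + 1 = k → Y.card ≤ ρ Y + M := by
  have hlt : 1 < Fintype.card A := hA
  induction s with
  -- Rank `k - 1`: deleting the complement identifies codewords, so it has at least `d` elements.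
  -- Lower ranks reduce to this by adding unspanned elements, which leave the nullity unchanged.
  | zero =>
    intro Y hY
    have h1 : d ≤ Yᶜ.card := by
      refine hd.2 ⟨Yᶜ, rfl, ?_⟩
      rw [compl_compl, ← ncard_codeProj_univ, hρ, hρ, Nat.pow_lt_pow_iff_right hlt]
      omega
    have h2 := Finset.card_add_card_compl Y
    rw [Fintype.card_fin] at h2
    omega
  | succ s ih =>
    intro Y hY
    obtain ⟨i, hi⟩ : ∃ i, ρ (insert i Y) ≠ ρ Y := by
      by_contra! h
      have := hR.union_eq_of_span Y Finset.univ fun i _ => h i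
      rw [Finset.union_eq_right.2 (Finset.subset_univ Y)] at this
      omega
    have h1 := hR.le_insert Y i
    have h2 := hR.insert_le Y i
    have h3 := ih (insert i Y) (by omega)
    have hiY : i ∉ Y := fun h => hi (by rw [Finset.insert_eq_of_mem h])
    rw [Finset.card_insert_of_notMem hiY] at h3
    omega

/-- For an almost affine LRC attaining the Singleton-type bound, with `k = (a + g + 1) r - a`. -/
theorem IsLRC.exists_cover_deficiency_le (hA : 2 ≤ Fintype.card A) (hC : IsAlmostAffine C)
    {k d r δ a g : ℕ} (hLRC : IsLRC C k d r δ) (ha : a + k = (a + g + 1) * r) (har : a < r)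
    (hg : 1 ≤ g) (hopt : n + 1 ≤ d + k + (a + g) * (δ - 1)) :
    ∃ m : ℕ, n ≤ m * (r + (δ - 1)) ∧
      (((a / g : ℕ) : ℤ) + 1) * ((m : ℤ) * (r + (δ - 1 : ℕ)) - n - a)
        + (a / g : ℕ) * ((a : ℤ) + g) ≤ (a / g : ℕ) * (m : ℤ) := by
  obtain ⟨ρ, hR, hρ⟩ := hC.exists_rankFunction hA
  have hδ := hLRC.two_le_delta
  have hlt : 1 < Fintype.card A := hA
  have hk : ρ Finset.univ = k := by
    rw [← Nat.pow_right_inj hlt, ← hρ, ncard_codeProj_univ, hLRC.card_eq]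
  have hHk : (a + g) * r < k := by
    rw [add_mul (a + g), one_mul] at ha
    omega
  have hcov : ∀ i, ∃ S, i ∈ S ∧ IsRankLocal ρ r (δ - 1) S := fun i => by
    obtain ⟨S, hi, hS⟩ := hLRC.locality i
    exact ⟨S, hi, hS.isRankLocal hA hρ (by omega) ⟨i, hi⟩⟩
  have := _root_.exists_cover_deficiency_le hR hHk hk hcov (by omega) ha
    (fun Y hY => hLRC.minDist.card_le_rank_add hA hρ hR hk hopt (k - 1 - ρ Y) Y (by omega)) hg rfl
  simpa using this

/-- The parameters of an almost affine LRC attaining the Singleton-type bound. -/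
theorem IsLRC.deficiency_le (hA : 2 ≤ Fintype.card A) (hC : IsAlmostAffine C)
    {k d r δ : ℕ} (hLRC : IsLRC C k d r δ) {h N a b : ℤ}
    (hh : h = ⌈(k : ℚ) / (r : ℚ)⌉)
    (hN : N = ⌈(n : ℚ) / ((r : ℚ) + (δ : ℚ) - 1)⌉)
    (ha : a = h * (r : ℤ) - (k : ℤ))
    (hb : b = N * ((r : ℤ) + (δ : ℤ) - 1) - (n : ℤ)) (hah : a < h - 1)
    (hopt : (n : ℤ) - (k : ℤ) + 1 - (h - 1) * ((δ : ℤ) - 1) ≤ d) :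
    0 ≤ a ∧ (a / (h - 1 - a) + 1) * (b - a) + a / (h - 1 - a) * (h - 1)
      ≤ a / (h - 1 - a) * N := by
  have hr := hLRC.one_le_r
  have hδ := hLRC.two_le_delta
  have hr' : (0 : ℚ) < r := by exact_mod_cast hr
  have hδ' : (2 : ℚ) ≤ δ := by exact_mod_cast hδ
  have ha0 : 0 ≤ a := by
    have h1 : (k : ℚ) / r ≤ h := hh ▸ Int.le_ceil _
    rw [div_le_iff₀ hr'] at h1
    have h2 : (k : ℤ) ≤ h * r := by exact_mod_cast h1
    linarith
  have har : a < r := by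
    have h1 : (h : ℚ) < (k : ℚ) / r + 1 := hh ▸ Int.ceil_lt_add_one _
    rw [← sub_lt_iff_lt_add, lt_div_iff₀ hr'] at h1
    have h2 : (h - 1) * (r : ℤ) < k := by exact_mod_cast h1
    linarith
  refine ⟨ha0, ?_⟩
  obtain ⟨g, hg⟩ : ∃ g, g = h - 1 - a := ⟨_, rfl⟩
  rw [← hg]
  have hg1 : 1 ≤ g := by omega
  obtain rfl : h = a + g + 1 := by omega
  lift a to ℕ using ha0
  lift g to ℕ using (by omega)
  obtain ⟨μ, rfl⟩ : ∃ μ, δ = μ + 1 := ⟨δ - 1, by omega⟩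
  push_cast at hopt hb hN
  obtain ⟨m, hm1, hm2⟩ := hLRC.exists_cover_deficiency_le hA hC (a := a) (g := g)
    (by zify; linarith) (by omega) (by omega) (by zify; simp only [Nat.add_sub_cancel]; linarith)
  simp only [Nat.add_sub_cancel] at hm1 hm2
  have hNm : N ≤ m := by
    rw [hN, Int.ceil_le]
    have hpos : (0 : ℚ) < r + (μ + 1) - 1 := by
      push_cast at hδ'
      linarith
    rw [div_le_iff₀ hpos]
    have : (n : ℚ) ≤ m * (r + μ) := by exact_mod_cast hm1
    push_cast
    linarith
  rw [← Int.natCast_div]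
  generalize a / g = t at *
  have hrμ : (1 : ℤ) ≤ r + μ := by omega
  -- Passing from `m` to `N ≤ m` only weakens the inequality, by `(m - N) ((t + 1) (r + μ) - t) ≥
  -- 0`.
  have h1 : 0 ≤ (m - N) * ((r : ℤ) + μ - 1) :=
    mul_nonneg (by omega) (by omega)
  have h2 : 0 ≤ (t : ℤ) * ((m - N) * ((r : ℤ) + μ - 1)) := mul_nonneg (by omega) h1
  rw [hb]
  linarith

end AlmostAffine

theorem mainTheorem8 {A : Type*} [Fintype A] (hA : 2 ≤ Fintype.card A)
    (n k d r δ : ℕ) (C : Set (Fin n → A)) (hC : IsAlmostAffine C) (hLRC : IsLRC C k d r δ)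
    (h N a b : ℤ)
    (hh : h = ⌈(k : ℚ) / (r : ℚ)⌉)
    (hN : N = ⌈(n : ℚ) / ((r : ℚ) + (δ : ℚ) - 1)⌉)
    (ha : a = h * (r : ℤ) - (k : ℤ))
    (hb : b = N * ((r : ℤ) + (δ : ℤ) - 1) - (n : ℤ)) :
    (a < b → a < ⌊(h : ℚ) / 2⌋ →
      (d : ℤ) < (n : ℤ) - (k : ℤ) + 1 - (h - 1) * ((δ : ℤ) - 1)) ∧
    (a < b → ⌊(h : ℚ) / 2⌋ ≤ a → a < h - 1 →
      (∀ t : ℤ, t = ⌊(a : ℚ) / ((h : ℚ) - 1 - (a : ℚ))⌋ →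
        (N : ℚ) < (h : ℚ) - 1 + ((b : ℚ) - (a : ℚ)) * (1 + 1 / (t : ℚ)) →
        (d : ℤ) < (n : ℤ) - (k : ℤ) + 1 - (h - 1) * ((δ : ℤ) - 1))) := by
  have hhalf : ⌊(h : ℚ) / 2⌋ = h / 2 := by
    have := Rat.floor_intCast_div_natCast h 2
    simpa using this
  rw [hhalf]
  have hh1 : 0 < h := by
    rw [hh, Int.ceil_pos]
    have h1 : (0 : ℚ) < r := by exact_mod_cast hLRC.one_le_r
    have h2 : (0 : ℚ) < k := by exact_mod_cast hLRC.one_le_r.trans hLRC.r_le_k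
    positivity
  refine ⟨fun hab hah => ?_, fun hab hha hah t ht hlt => ?_⟩ <;> by_contra! hcon
  · obtain ⟨ha0, key⟩ := hLRC.deficiency_le hA hC hh hN ha hb (by omega) hcon
    -- Here `a < h - 1 - a`, so the quotient vanishes and the inequality reads `b ≤ a`.
    rw [Int.ediv_eq_zero_of_lt (by omega) (by omega)] at key
    linarith
  · have key := (hLRC.deficiency_le hA hC hh hN ha hb hah hcon).2
    have hg : 0 < h - 1 - a := by omega
    have ht' : t = a / (h - 1 - a) := by
      lift h - 1 - a to ℕ using hg.le with g hgdef
      have hq : (h : ℚ) - 1 - a = (g : ℕ) := by exact_mod_cast hgdef.symm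
      rw [ht, hq, Rat.floor_intCast_div_natCast]
    rw [← ht'] at key
    have ht1 : 1 ≤ t := by
      rw [ht', Int.le_ediv_iff_mul_le hg]
      omega
    have ht0 : (0 : ℚ) < t := by exact_mod_cast ht1
    have h1 := mul_lt_mul_of_pos_left hlt ht0
    have h2 : (t : ℚ) * ((h : ℚ) - 1 + ((b : ℚ) - a) * (1 + 1 / t))
        = (t + 1) * (b - a) + t * (h - 1) := by
      field_simp
      ring
    rw [h2] at h1
    have h3 : t * N < (t + 1) * (b - a) + t * (h - 1) := by exact_mod_cast h1
    linarith
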